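/- Let $A$ be a separable unital $C^*$-algebra, let $n\ge 1$ be an integer, and let $\alpha\colon\mathbb{T}\to\mathrm{Aut}(A)$ be an action of the circle group that is continuous for the topology of pointwise norm convergence on $\mathrm{Aut}(A)$. Suppose that $\alpha$ has the Rokhlin property: for every finite set $F\subseteq A$ and every $\varepsilon>0$ there is a unitary $u\in A$ such that $\|\alpha_\zeta(u)-\zeta u\|<\varepsilon$ for all $\zeta\in\mathbb{T}$ and $\|ua-au\|<\varepsilon$ for all $a\in F$. Suppose moreover that $A$ absorbs the UHF algebra $M_{n^\infty}=\varinjlim_k\,(M_{n^k},\,x\mapsto x\otimes 1_{M_n})$, that is, $A\cong A\otimes M_{n^\infty}$. Regard $\mathbb{Z}_n$ as the subgroup of $n$-th roots of unity in $\mathbb{T}$, with $k\in\mathbb{Z}_n$ corresponding to $e^{2\pi i k/n}$. Then the restriction $\alpha|_{\mathbb{Z}_n}\colon\mathbb{Z}_n\to\mathrm{Aut}(A)$ has the Rokhlin property: for every finite set $F\subseteq A$ and every $\varepsilon>0$ there are pairwise orthogonal projections $e_g\in A$, for $g\in\mathbb{Z}_n$, such that 1. $\|\alpha_g(e_h)-e_{gh}\|<\varepsilon$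 for all $g,h\in\mathbb{Z}_n$ (the group being written multiplicatively), 2. $\|e_g a-a e_g\|<\varepsilon$ for all $g\in\mathbb{Z}_n$ and all $a\in F$, and 3. $\sum_{g\in\mathbb{Z}_n}e_g=1$. -/

import Mathlib

open scoped TensorProduct

noncomputable section

namespace RokhlinCircle

/-! ### The UHF algebra `M_{n^∞}` -/

/-- The Hilbert space `ℓ²` over the set of all infinite words in the alphabet `{0, …, n-1}`. -/
abbrev WordSpace (n : ℕ) : Type := lp (fun _ : ℕ → Fin n => ℂ) 2

/-- The entries of `e_{ij}^{(k)} ξ`: at a word `w` with `k`-th letter `i` it is the value of `ξ` at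
the word obtained from `w` by replacing the `k`-th letter by `j`; elsewhere it is zero. -/
def siteFun (n k : ℕ) (i j : Fin n) (ξ : (ℕ → Fin n) → ℂ) (w : ℕ → Fin n) : ℂ :=
  if w k = i then ξ (Function.update w k j) else 0

theorem siteFun_bound (n k : ℕ) (i j : Fin n) (ξ : WordSpace n) (s : Finset (ℕ → Fin n)) :
    ∑ w ∈ s, ‖siteFun n k i j ξ w‖ ^ (2 : ENNReal).toReal ≤ ‖ξ‖ ^ (2 : ENNReal).toReal := by
  classical
  have h2 : 0 < (2 : ENNReal).toReal := by norm_num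
  have hinj : Set.InjOn (fun w : ℕ → Fin n => Function.update w k j)
      (s.filter fun w => w k = i : Finset (ℕ → Fin n)) := by
    intro v hv w hw h
    simp only [Finset.coe_filter, Set.mem_ofPred_eq] at hv hw
    funext l
    by_cases hl : l = k
    · subst hl; rw [hv.2, hw.2]
    · simpa [hl] using congrFun h l
  calc ∑ w ∈ s, ‖siteFun n k i j ξ w‖ ^ (2 : ENNReal).toReal
      = ∑ w ∈ s.filter (fun w => w k = i),
          ‖ξ (Function.update w k j)‖ ^ (2 : ENNReal).toReal := by
        rw [Finset.sum_filter]
        refine Finset.sum_congr rfl fun w _ => ?_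
        by_cases h : w k = i <;> simp [siteFun, h]
    _ = ∑ v ∈ (s.filter fun w => w k = i).image (fun w => Function.update w k j),
          ‖ξ v‖ ^ (2 : ENNReal).toReal := by
        exact (Finset.sum_image (f := fun v => ‖ξ v‖ ^ (2 : ENNReal).toReal) hinj).symm
    _ ≤ ‖ξ‖ ^ (2 : ENNReal).toReal := lp.sum_rpow_le_norm_rpow h2 ξ _

/-- The matrix unit `e_{ij}` of `M_n`, acting on the `k`-th letter, as a bounded operator: it maps
the basis vector of a word `w` to that of the word with `k`-th letter `i` if the `k`-th letter of
`w` is `j`, and to `0` otherwise. -/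
def siteUnit (n k : ℕ) (i j : Fin n) : WordSpace n →L[ℂ] WordSpace n :=
  LinearMap.mkContinuous
    { toFun := fun ξ => ⟨siteFun n k i j ξ, memℓp_gen' (siteFun_bound n k i j ξ)⟩
      map_add' := by
        intro ξ η
        ext w
        change siteFun n k i j (ξ + η : WordSpace n) w = siteFun n k i j ξ w + siteFun n k i j η w
        by_cases h : w k = i <;> simp [siteFun, h]
      map_smul' := by
        intro c ξ
        ext w
        by_cases h : w k = i <;> simp [siteFun, h] }
    1 (by
      intro ξ
      rw [one_mul]
      exact lp.norm_le_of_forall_sum_le (by norm_num) (norm_nonneg ξ) (siteFun_bound n k i j ξ))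

/-- The UHF algebra `M_{n^∞} = M_n ⊗ M_n ⊗ ⋯`, realised on `ℓ²` of the infinite words: the
operators `e_{ij}^{(k)}` with `k < m` generate a copy of `M_{n^m} = M_n ⊗ ⋯ ⊗ M_n` (`m` factors),
these copies increase with `m` along the unital inclusions `x ↦ x ⊗ 1`, and `M_{n^∞}` is the norm
closure of their union. -/
def uhfSubalgebra (n : ℕ) : StarSubalgebra ℂ (WordSpace n →L[ℂ] WordSpace n) :=
  (StarAlgebra.adjoin ℂ
    {T | ∃ (k : ℕ) (i j : Fin n), T = siteUnit n k i j}).topologicalClosure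

/-- The C*-algebra `M_{n^∞}`. -/
abbrev UHF (n : ℕ) : Type := uhfSubalgebra n

instance (n : ℕ) : IsClosed (uhfSubalgebra n : Set (WordSpace n →L[ℂ] WordSpace n)) :=
  StarSubalgebra.isClosed_topologicalClosure _

instance (n : ℕ) : CStarAlgebra (UHF n) := StarSubalgebra.cstarAlgebra (uhfSubalgebra n)

/-! ### Tensor products and absorption -/

/-- The unital C*-algebra `C`, with the maps `i : A → C` (`a ↦ a ⊗ 1`) and `j : B → C`
(`b ↦ 1 ⊗ b`), is a C*-tensor product of `A` and `B`, that is, the completion of the algebraic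
tensor product of `A` and `B` in some C*-norm. If `A` or `B` is nuclear, there is only one C*-norm
on the algebraic tensor product, and `C` is the tensor product `A ⊗ B`. -/
structure IsCStarTensorProduct {A B C : Type*} [CStarAlgebra A] [CStarAlgebra B] [CStarAlgebra C]
    (i : A →⋆ₐ[ℂ] C) (j : B →⋆ₐ[ℂ] C) : Prop where
  commute : ∀ a b, Commute (i a) (j b)
  injective : Function.Injective
    (Algebra.TensorProduct.lift i.toAlgHom j.toAlgHom commute : A ⊗[ℂ] B →ₐ[ℂ] C)
  denseRange : DenseRange
    (Algebra.TensorProduct.lift i.toAlgHom j.toAlgHom commute : A ⊗[ℂ] B →ₐ[ℂ] C)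

/-- `A` absorbs `M_{n^∞}`, that is, `A ≅ A ⊗ M_{n^∞}`: the C*-algebra `A` itself carries the
structure of a tensor product of `A` and the nuclear C*-algebra `M_{n^∞}`. -/
def AbsorbsUHF (n : ℕ) (A : Type*) [CStarAlgebra A] : Prop :=
  ∃ (i : A →⋆ₐ[ℂ] A) (j : UHF n →⋆ₐ[ℂ] A), IsCStarTensorProduct i j

/-! ### Actions and Rokhlin properties -/

/-- Continuity of `α : G → Aut(A)` for the topology of pointwise norm convergence on `Aut(A)`. -/
def IsContinuousAction {G A : Type*} [Group G] [TopologicalSpace G] [CStarAlgebra A]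
    (α : G →* (A ≃⋆ₐ[ℂ] A)) : Prop :=
  ∀ a : A, Continuous fun g => α g a

/-- The Rokhlin property for a circle action. -/
def CircleRokhlin {A : Type*} [CStarAlgebra A] (α : Circle →* (A ≃⋆ₐ[ℂ] A)) : Prop :=
  ∀ (F : Finset A) (ε : ℝ), 0 < ε → ∃ u ∈ unitary A,
    (∀ ζ : Circle, ‖α ζ u - (ζ : ℂ) • u‖ < ε) ∧ ∀ a ∈ F, ‖u * a - a * u‖ < ε

/-- The Rokhlin property for an action of a finite group. -/
def FiniteRokhlin {G A : Type*} [Group G] [Fintype G] [CStarAlgebra A]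
    (β : G →* (A ≃⋆ₐ[ℂ] A)) : Prop :=
  ∀ (F : Finset A) (ε : ℝ), 0 < ε → ∃ e : G → A,
    (∀ g, IsStarProjection (e g)) ∧ (∀ g h, g ≠ h → e g * e h = 0) ∧
    (∀ g h, ‖β g (e h) - e (g * h)‖ < ε) ∧
    (∀ g, ∀ a ∈ F, ‖e g * a - a * e g‖ < ε) ∧
    ∑ g, e g = 1

/-- The restriction of a circle action to `ℤ_n`, where `k ∈ ℤ_n` is identified with the `n`-th root
of unity `exp(2πik/n)`. -/
def restrictCyclic {A : Type*} [CStarAlgebra A] (α : Circle →* (A ≃⋆ₐ[ℂ] A)) (n : ℕ) [NeZero n] :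
    Multiplicative (ZMod n) →* (A ≃⋆ₐ[ℂ] A) :=
  α.comp (ZMod.toCircle (N := n)).toMonoidHom

end RokhlinCircle

end

/-!
Functional calculus of unitaries `u` as in the Rokhlin property gives homomorphisms `C(𝕋) → A` that
are asymptotically central and intertwine the rotations of `𝕋` with `α`. They allow us to evaluate
`f : 𝕋 → A` at `u`: for a fine quadratic partition of unity `∑ |hₖ|² = 1` with tags `zₖ`, the
Riemann sums `∑ hₖ(u)* α_{zₖ}⁻¹(f(zₖ)) hₖ(u)` define asymptotic homomorphisms `C(𝕋, A) → A` which
are equivariant for the rotations of `𝕋` and send the orbit map `z ↦ α_z(a)` to `a` in the limit.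

It is therefore enough to find a partition of unity into projections in `C(𝕋, A)` that is permuted
by the rotations by `n`-th roots of unity and almost commutes with finitely many orbit maps. In
`C(𝕋, M_n)` the vectors `n^{-1/2} (1, w, …, w^{n-1})`, with `w` in the coset of `z` modulo the roots
of unity, form an orthonormal basis and span such projections; the tensor factors of `M_{n^∞}` are
asymptotically central copies of `M_n` in `A`, which transport them to `C(𝕋, A)`. The images in `A`
are almost projections, and become a partition of unity into projections by functional calculus:
the self-adjoint element `∑ j pⱼ` has spectrum close to the integers.
-/

noncomputable section

namespace RokhlinCircle

open Filter Topology

section AsymptoticallyCentral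

variable {A B ι : Type*} [CStarAlgebra A] [CStarAlgebra B] {l : Filter ι}

/-- The family `T` asymptotically commutes, along `l`, with each element of `A`: it represents an
element of the relative commutant of `A` in its sequence algebra. -/
def IsAsymptoticallyCentral (l : Filter ι) (T : ι → A) : Prop :=
  ∀ a, Tendsto (fun i => T i * a - a * T i) l (𝓝 0)

theorem isBoundedUnder_norm_map (γ : ι → B →⋆ₐ[ℂ] A) (b : B) :
    IsBoundedUnder (· ≤ ·) l (norm ∘ fun i => γ i b) :=
  isBoundedUnder_of ⟨‖b‖, fun i => NonUnitalStarAlgHom.norm_apply_le (γ i) b⟩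

/-- The elements `b` for which both `b` and `star b` satisfy `γ i b * T i - T i * δ i b → 0`. With
`γ = δ` it is an asymptotic commutant of `T`, with `T = 1` the asymptotic equalizer of `γ` and
`δ`. -/
def asymptoticIntertwiner (l : Filter ι) (γ δ : ι → B →⋆ₐ[ℂ] A) (T : ι → A) :
    StarSubalgebra ℂ B where
  carrier := {b | Tendsto (fun i => γ i b * T i - T i * δ i b) l (𝓝 0) ∧
    Tendsto (fun i => γ i (star b) * T i - T i * δ i (star b)) l (𝓝 0)}
  mul_mem' := by
    have mul : ∀ b c, Tendsto (fun i => γ i b * T i - T i * δ i b) l (𝓝 0) →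
        Tendsto (fun i => γ i c * T i - T i * δ i c) l (𝓝 0) →
        Tendsto (fun i => γ i (b * c) * T i - T i * δ i (b * c)) l (𝓝 0) := by
      intro b c hb hc
      have h := (isBoundedUnder_le_mul_tendsto_zero (isBoundedUnder_norm_map γ b) hc).add
        (hb.zero_mul_isBoundedUnder_le (isBoundedUnder_norm_map δ c))
      rw [add_zero] at h
      exact h.congr fun i => by simp only [map_mul]; noncomm_ring
    rintro b c ⟨hb, hb'⟩ ⟨hc, hc'⟩
    exact ⟨mul b c hb hc, by simpa only [star_mul] using mul _ _ hc' hb'⟩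
  add_mem' := by
    have add : ∀ b c, Tendsto (fun i => γ i b * T i - T i * δ i b) l (𝓝 0) →
        Tendsto (fun i => γ i c * T i - T i * δ i c) l (𝓝 0) →
        Tendsto (fun i => γ i (b + c) * T i - T i * δ i (b + c)) l (𝓝 0) := by
      intro b c hb hc
      have h := hb.add hc
      rw [add_zero] at h
      exact h.congr fun i => by simp only [map_add]; noncomm_ring
    rintro b c ⟨hb, hb'⟩ ⟨hc, hc'⟩
    exact ⟨add b c hb hc, by simpa only [star_add] using add _ _ hb' hc'⟩
  algebraMap_mem' := fun c => by
    simpa only [← algebraMap_star_comm, Set.mem_ofPred_eq, AlgHomClass.commutes,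
      Algebra.commutes, sub_self, and_self] using tendsto_const_nhds
  star_mem' := fun ⟨hb, hb'⟩ => ⟨hb', by simpa only [star_star] using hb⟩

theorem isClosed_asymptoticIntertwiner (γ δ : ι → B →⋆ₐ[ℂ] A) {T : ι → A} {C : ℝ}
    (hT : ∀ i, ‖T i‖ ≤ C) : IsClosed (asymptoticIntertwiner l γ δ T : Set B) := by
  have lipschitz : ∀ i, LipschitzWith (2 * C).toNNReal fun b => γ i b * T i - T i * δ i b := by
    refine fun i => LipschitzWith.of_dist_le_mul fun b c => ?_
    rw [dist_eq_norm, dist_eq_norm, Real.coe_toNNReal _ (by linarith [norm_nonneg (T i), hT i])]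
    calc ‖γ i b * T i - T i * δ i b - (γ i c * T i - T i * δ i c)‖
        = ‖γ i (b - c) * T i - T i * δ i (b - c)‖ := by
          simp only [map_sub]; congr 1; noncomm_ring
      _ ≤ ‖b - c‖ * C + C * ‖b - c‖ := (norm_sub_le _ _).trans <| add_le_add
          (norm_mul_le_of_le (NonUnitalStarAlgHom.norm_apply_le _ _) (hT i))
          (norm_mul_le_of_le (hT i) (NonUnitalStarAlgHom.norm_apply_le _ _))
      _ = 2 * C * ‖b - c‖ := by ring
  have closed := (LipschitzWith.uniformEquicontinuous _ _ lipschitz).equicontinuous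
    |>.isClosed_setOfPred_tendsto (l := l) (continuous_const (y := (0 : A)))
  exact closed.inter (closed.preimage continuous_star)

open scoped CStarAlgebra in
theorem IsAsymptoticallyCentral.comp_continuousMap {K : Type*} [TopologicalSpace K]
    [CompactSpace K] {μ : ι → B →⋆ₐ[ℂ] A}
    (hμ : ∀ b, IsAsymptoticallyCentral l fun i => μ i b) (Q : C(K, B)) :
    IsAsymptoticallyCentral l fun i =>
      ContinuousMap.compStarAlgHom K (μ i) (map_continuous (μ i)) Q := by
  intro f
  have modulus : ∀ z₀ z i, dist (μ i (Q z₀) * f z₀ - f z₀ * μ i (Q z₀))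
      (μ i (Q z) * f z - f z * μ i (Q z)) ≤
      2 * (‖Q z₀ - Q z‖ * ‖f z₀‖ + ‖Q z‖ * ‖f z₀ - f z‖) := by
    intro z₀ z i
    have h₁ := norm_mul_le_of_le (NonUnitalStarAlgHom.norm_apply_le (μ i) (Q z₀ - Q z))
      (le_refl ‖f z₀‖)
    have h₂ := norm_mul_le_of_le (NonUnitalStarAlgHom.norm_apply_le (μ i) (Q z))
      (le_refl ‖f z₀ - f z‖)
    have h₃ := norm_mul_le_of_le (le_refl ‖f z₀‖)
      (NonUnitalStarAlgHom.norm_apply_le (μ i) (Q z₀ - Q z))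
    have h₄ := norm_mul_le_of_le (le_refl ‖f z₀ - f z‖)
      (NonUnitalStarAlgHom.norm_apply_le (μ i) (Q z))
    rw [dist_eq_norm]
    calc _ = ‖μ i (Q z₀ - Q z) * f z₀ + μ i (Q z) * (f z₀ - f z) -
            (f z₀ * μ i (Q z₀ - Q z) + (f z₀ - f z) * μ i (Q z))‖ := by
          rw [map_sub]; congr 1; noncomm_ring
      _ ≤ _ := (norm_sub_le _ _).trans (add_le_add (norm_add_le_of_le h₁ h₂)
          (norm_add_le_of_le h₃ h₄))
      _ = _ := by ring
  have equicontinuous : Equicontinuous fun i z => μ i (Q z) * f z - f z * μ i (Q z) :=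
    fun z₀ => Metric.equicontinuousAt_of_continuity_modulus _
      (Continuous.tendsto' (by fun_prop) z₀ 0 (by simp)) _
      (Eventually.of_forall fun z i => modulus z₀ z i)
  rw [ContinuousMap.tendsto_iff_tendstoUniformly]
  exact UniformFun.tendsto_iff_tendstoUniformly.1
    ((equicontinuous.tendsto_uniformFun_iff_pi l 0).2 (tendsto_pi_nhds.2 fun z => hμ (Q z) (f z)))

end AsymptoticallyCentral

section CompressionSum

theorem norm_sum_star_mul_mul_le {A κ : Type*} [CStarAlgebra A] [Fintype κ] (b y : κ → A) {c : ℝ}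
    (hc : 0 ≤ c) (hy : ∀ k, b k ≠ 0 → ‖y k‖ ≤ c) :
    ‖∑ k, star (b k) * y k * b k‖ ≤ c * ‖∑ k, star (b k) * b k‖ := by
  let _ : PartialOrder A := CStarAlgebra.spectralOrder A
  have : StarOrderedRing A := CStarAlgebra.spectralOrderedRing A
  -- The sum is an inner product in the Hilbert module `A ^ κ`: apply Cauchy-Schwarz.
  let v : WithCStarModule A (κ → A) := (WithCStarModule.equiv A _).symm fun k => star (b k)
  let w : WithCStarModule A (κ → A) := (WithCStarModule.equiv A _).symm fun k => star (b k) * y k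
  have inner_vw : inner A v w = ∑ k, star (b k) * y k * b k := by
    simp [v, w, WithCStarModule.pi_inner, WithCStarModule.inner_def]
  have norm_v : ‖v‖ ^ 2 = ‖∑ k, star (b k) * b k‖ := by
    simp [v, WithCStarModule.pi_norm_sq, WithCStarModule.inner_def]
  have inner_w_le : ∀ k, inner A (w k) (w k) ≤ c ^ 2 • (star (b k) * b k) := by
    intro k
    obtain hb | hb := eq_or_ne (b k) 0
    · simp [w, WithCStarModule.inner_def, hb]
    calc inner A (w k) (w k) = star (b k) * (y k * star (y k)) * b k := by
          simp [w, WithCStarModule.inner_def, mul_assoc]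
      _ ≤ ‖y k * star (y k)‖ • (star (b k) * b k) :=
          CStarAlgebra.star_left_conjugate_le_norm_smul (.mul_star_self _)
      _ ≤ c ^ 2 • (star (b k) * b k) := by
          rw [CStarRing.norm_self_mul_star, ← sq]
          gcongr
          exacts [star_mul_self_nonneg _, hy k hb]
  have norm_w : ‖w‖ ≤ c * ‖v‖ := by
    refine (pow_le_pow_iff_left₀ (CStarModule.norm_nonneg A)
      (mul_nonneg hc (CStarModule.norm_nonneg A)) two_ne_zero).1 ?_
    rw [mul_pow, norm_v, WithCStarModule.pi_norm_sq, ← Real.norm_of_nonneg (sq_nonneg c),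
      ← norm_smul, Finset.smul_sum]
    exact CStarAlgebra.norm_le_norm_of_nonneg_of_le
      (Finset.sum_nonneg fun k _ => CStarModule.inner_self_nonneg)
      (Finset.sum_le_sum fun k _ => inner_w_le k)
  rw [← inner_vw, ← norm_v]
  calc ‖inner A v w‖ ≤ ‖v‖ * ‖w‖ := CStarModule.norm_inner_le _
    _ ≤ ‖v‖ * (c * ‖v‖) := mul_le_mul_of_nonneg_left norm_w (CStarModule.norm_nonneg A)
    _ = c * ‖v‖ ^ 2 := by ring

variable {A B K ι κ κ' : Type*} [CStarAlgebra A] [CStarAlgebra B] [TopologicalSpace K] [Fintype κ]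
  [Fintype κ'] {l : Filter ι}

/-- The completely positive map `y ↦ ∑ k, γ(h k)* y(k) γ(h k)` compressing a tuple by the images of
functions `h k` under a representation `γ` of `C(K, ℂ)`. -/
def compressionSum (γ : C(K, ℂ) →⋆ₐ[ℂ] A) (h : κ → C(K, ℂ)) : (κ → A) →ₗ[ℂ] A :=
  ∑ k, LinearMap.mulLeftRight ℂ (star (γ (h k)), γ (h k)) ∘ₗ LinearMap.proj k

theorem compressionSum_apply (γ : C(K, ℂ) →⋆ₐ[ℂ] A) (h : κ → C(K, ℂ)) (y : κ → A) :
    compressionSum γ h y = ∑ k, star (γ (h k)) * y k * γ (h k) := by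
  simp [compressionSum]

theorem compressionSum_one (γ : C(K, ℂ) →⋆ₐ[ℂ] A) {h : κ → C(K, ℂ)}
    (hh : ∑ k, star (h k) * h k = 1) : compressionSum γ h 1 = 1 := by
  simp only [compressionSum_apply, Pi.one_apply, mul_one, ← map_star, ← map_mul, ← map_sum, hh,
    map_one]

theorem compressionSum_star (γ : C(K, ℂ) →⋆ₐ[ℂ] A) (h : κ → C(K, ℂ)) (y : κ → A) :
    compressionSum γ h (star y) = star (compressionSum γ h y) := by
  simp only [compressionSum_apply, star_sum, star_mul, star_star, Pi.star_apply, mul_assoc]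

theorem map_compressionSum (β : A →⋆ₐ[ℂ] B) (γ : C(K, ℂ) →⋆ₐ[ℂ] A) (h : κ → C(K, ℂ)) (y : κ → A) :
    β (compressionSum γ h y) = compressionSum (β.comp γ) h fun k => β (y k) := by
  simp only [compressionSum_apply, map_sum, map_mul, map_star, StarAlgHom.comp_apply]

theorem norm_compressionSum_le (γ : C(K, ℂ) →⋆ₐ[ℂ] A) {h : κ → C(K, ℂ)}
    (hh : ∑ k, star (h k) * h k = 1) {y : κ → A} {c : ℝ} (hc : 0 ≤ c)
    (hy : ∀ k z, h k z ≠ 0 → ‖y k‖ ≤ c) : ‖compressionSum γ h y‖ ≤ c := by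
  have norm_one_le : ‖(1 : A)‖ ≤ 1 := by
    obtain _ | _ := subsingleton_or_nontrivial A
    · simp [norm_of_subsingleton]
    · exact CStarRing.norm_one.le
  have hy' : ∀ k, γ (h k) ≠ 0 → ‖y k‖ ≤ c := by
    intro k hk
    obtain ⟨z, hz⟩ := DFunLike.ne_iff.1 (ne_of_apply_ne γ (hk.trans_eq (map_zero γ).symm))
    exact hy k z hz
  calc ‖compressionSum γ h y‖ ≤ c * ‖∑ k, star (γ (h k)) * γ (h k)‖ := by
        rw [compressionSum_apply]
        exact norm_sum_star_mul_mul_le _ _ hc hy'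
    _ ≤ c := by
        simp only [← map_star, ← map_mul, ← map_sum, hh, map_one]
        exact mul_le_of_le_one_right hc norm_one_le

theorem sum_star_mul_self_prod {h : κ → C(K, ℂ)} {h' : κ' → C(K, ℂ)}
    (hh : ∑ k, star (h k) * h k = 1) (hh' : ∑ k, star (h' k) * h' k = 1) :
    ∑ p : κ × κ', star (h p.1 * h' p.2) * (h p.1 * h' p.2) = 1 := by
  calc _ = (∑ k, star (h k) * h k) * ∑ k, star (h' k) * h' k := by
        simp only [Finset.sum_mul_sum, Fintype.sum_prod_type, star_mul]
        refine Finset.sum_congr rfl fun k _ => Finset.sum_congr rfl fun k' _ => by ring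
    _ = 1 := by rw [hh, hh', one_mul]

theorem tendsto_compressionSum_mul_sub [CompactSpace K] {γ : ι → C(K, ℂ) →⋆ₐ[ℂ] A}
    (hγ : ∀ φ, IsAsymptoticallyCentral l fun i => γ i φ) (h : κ → C(K, ℂ)) (h' : κ' → C(K, ℂ))
    (y : κ → A) (y' : κ' → A) :
    Tendsto (fun i => compressionSum (γ i) h y * compressionSum (γ i) h' y' -
      compressionSum (γ i) (fun p : κ × κ' => h p.1 * h' p.2) fun p => y p.1 * y' p.2)
      l (𝓝 0) := by
  simp only [compressionSum_apply, Finset.sum_mul_sum, Fintype.sum_prod_type,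
    ← Finset.sum_sub_distrib]
  rw [← Finset.sum_const_zero (s := Finset.univ (α := κ))]
  refine tendsto_finsetSum _ fun k _ => ?_
  rw [← Finset.sum_const_zero (s := Finset.univ (α := κ'))]
  refine tendsto_finsetSum _ fun k' _ => ?_
  -- The inner factors `γ (h k)` and `star (γ (h' k'))` commute with each other, and asymptotically
  -- with the coefficients, which leaves the outer factors of the product family.
  have bounded φ := isBoundedUnder_norm_map (l := l) γ φ
  have h_left : Tendsto (fun i => (γ i (star (h' k')) * y k - y k * γ i (star (h' k'))) *
      γ i (h k) * y' k') l (𝓝 0) := by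
    simpa using ((hγ (star (h' k')) (y k)).zero_mul_isBoundedUnder_le
      (bounded (h k))).mul_const (y' k')
  have h_right : Tendsto (fun i => γ i (star (h' k')) *
      (y k * (γ i (h k) * y' k' - y' k' * γ i (h k)))) l (𝓝 0) :=
    isBoundedUnder_le_mul_tendsto_zero (bounded (star (h' k')))
      (by simpa using (hγ (h k) (y' k')).const_mul (y k))
  have h_mid := (isBoundedUnder_le_mul_tendsto_zero (bounded (star (h k)))
    (h_right.sub h_left |>.trans (by rw [sub_zero]))).zero_mul_isBoundedUnder_le (bounded (h' k'))
  refine h_mid.congr fun i => ?_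
  have comm : γ i (h k) * star (γ i (h' k')) = star (γ i (h' k')) * γ i (h k) := by
    rw [← map_star, ← map_mul, mul_comm, map_mul]
  calc _ = star (γ i (h k)) * y k * (star (γ i (h' k')) * γ i (h k)) * y' k' * γ i (h' k') -
        star (γ i (h k)) * star (γ i (h' k')) * (y k * y' k') * (γ i (h k) * γ i (h' k')) := by
        simp only [map_star]; noncomm_ring
    _ = _ := by
        rw [← comm, ← map_mul (γ i), mul_comm (h k) (h' k')]
        simp only [map_mul, star_mul, mul_assoc]

end CompressionSum

section RiemannSum

variable {A K ι : Type*} [CStarAlgebra A] {l : Filter ι}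

theorem eventually_norm_compressionSum_sub_le [TopologicalSpace K] [CompactSpace K]
    {κ κ' : Type*} [Fintype κ] [Fintype κ'] {γ : ι → C(K, ℂ) →⋆ₐ[ℂ] A}
    (hγ : ∀ φ, IsAsymptoticallyCentral l fun i => γ i φ) {h : κ → C(K, ℂ)} {h' : κ' → C(K, ℂ)}
    (hh : ∑ k, star (h k) * h k = 1) (hh' : ∑ k, star (h' k) * h' k = 1) {y : κ → A} {y' : κ' → A}
    {c ε : ℝ} (hc : 0 ≤ c) (hε : c < ε)
    (hy : ∀ k k' z, h k z ≠ 0 → h' k' z ≠ 0 → ‖y k - y' k'‖ ≤ c) :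
    ∀ᶠ i in l, ‖compressionSum (γ i) h y - compressionSum (γ i) h' y'‖ ≤ ε := by
  -- Both sums are asymptotically sums over the common refinement `h k * h' k'`.
  have limit := (tendsto_compressionSum_mul_sub hγ h h' y 1).sub
    (tendsto_compressionSum_mul_sub hγ h h' 1 y')
  rw [sub_zero] at limit
  filter_upwards [limit.norm.eventually_le_const (u := ε - c) (by simpa using hε)] with i hi
  simp only [compressionSum_one _ hh, compressionSum_one _ hh', mul_one, one_mul,
    Pi.one_apply] at hi
  have norm_sub_le := norm_compressionSum_le (γ i) (sum_star_mul_self_prod hh hh')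
    (y := (fun p => y p.1) - fun p => y' p.2) hc fun p z hz =>
      hy p.1 p.2 z (left_ne_zero_of_mul hz) (right_ne_zero_of_mul hz)
  rw [map_sub] at norm_sub_le
  refine ((norm_add_le_of_le hi norm_sub_le).trans_eq' ?_).trans_eq (sub_add_cancel ε c)
  congr 1
  abel

theorem tendsto_compressionSum_sub_compressionSum [TopologicalSpace K] [CompactSpace K]
    {κ : Type*} [Fintype κ] {γ δ : ι → C(K, ℂ) →⋆ₐ[ℂ] A}
    (hγδ : ∀ φ, Tendsto (fun i => γ i φ - δ i φ) l (𝓝 0)) (h : κ → C(K, ℂ)) (y : κ → A) :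
    Tendsto (fun i => compressionSum (γ i) h y - compressionSum (δ i) h y) l (𝓝 0) := by
  simp only [compressionSum_apply, ← Finset.sum_sub_distrib, ← map_star]
  rw [← Finset.sum_const_zero (s := Finset.univ (α := κ))]
  refine tendsto_finsetSum _ fun k _ => ?_
  have h_left : Tendsto (fun i => (γ i (star (h k)) - δ i (star (h k))) * y k) l (𝓝 0) := by
    simpa using (hγδ (star (h k))).mul_const (y k)
  have h_right : Tendsto (fun i => y k * (γ i (h k) - δ i (h k))) l (𝓝 0) := by
    simpa using (hγδ (h k)).const_mul (y k)
  have limit := (h_left.zero_mul_isBoundedUnder_le (isBoundedUnder_norm_map γ (h k))).add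
    (isBoundedUnder_le_mul_tendsto_zero (isBoundedUnder_norm_map δ (star (h k))) h_right)
  rw [add_zero] at limit
  exact limit.congr fun i => by noncomm_ring

variable [PseudoMetricSpace K]

/-- A finite quadratic partition of unity whose members are supported near chosen points of `K`. -/
structure TaggedPartition (K : Type*) [PseudoMetricSpace K] (δ : ℝ) where
  tags : Finset K
  weight : tags → C(K, ℂ)
  sum_star_mul_self : ∑ x, star (weight x) * weight x = 1
  dist_lt : ∀ x z, weight x z ≠ 0 → dist z x < δ

theorem TaggedPartition.nonempty [CompactSpace K] {δ : ℝ} (hδ : 0 < δ) :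
    Nonempty (TaggedPartition K δ) := by
  obtain ⟨ρ, hρ⟩ := PartitionOfUnity.exists_isSubordinate isClosed_univ
    (fun x : K => Metric.ball x δ) (fun _ => Metric.isOpen_ball)
    fun x _ => Set.mem_iUnion.2 ⟨x, Metric.mem_ball_self hδ⟩
  have finite : {x | (Function.support (ρ x)).Nonempty}.Finite :=
    ρ.locallyFinite.finite_nonempty_of_compact
  refine ⟨finite.toFinset, fun x => ⟨fun z => (√(ρ x z) : ℂ), by fun_prop⟩, ?_, fun x z hz => ?_⟩
  · ext z
    have sum_eq_one : ∑ x ∈ finite.toFinset, ρ x z = 1 :=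
      ρ.sum_finsupport' (Set.mem_univ z) fun x hx =>
        finite.mem_toFinset.2 ⟨z, (ρ.mem_finsupport z).1 hx⟩
    rw [← Finset.sum_attach] at sum_eq_one
    simp [← Complex.ofReal_mul, Real.mul_self_sqrt (ρ.nonneg _ z), ← Complex.ofReal_sum,
      sum_eq_one]
  · refine hρ x (subset_closure fun hx : ρ x z = 0 => hz ?_)
    simp [hx]

/-- The operator Riemann sum of `f` with respect to a representation `γ` of `C(K, ℂ)`. -/
def riemannSum {δ : ℝ} (γ : C(K, ℂ) →⋆ₐ[ℂ] A) (P : TaggedPartition K δ) : C(K, A) →ₗ[ℂ] A where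
  toFun f := compressionSum γ P.weight fun x => f x
  map_add' _ _ := map_add (compressionSum γ P.weight) _ _
  map_smul' _ _ := map_smul (compressionSum γ P.weight) _ _

variable [CompactSpace K] {ρ : Type*} {p : Filter ρ} {δ : ρ → ℝ}

theorem TaggedPartition.eventually_norm_sub_le (hδ : Tendsto δ p (𝓝 0))
    (P : ∀ r, TaggedPartition K (δ r)) (f : C(K, A)) {c : ℝ} (hc : 0 < c) :
    ∀ᶠ r in p, ∀ x z, (P r).weight x z ≠ 0 → ‖f x - f z‖ ≤ c := by
  obtain ⟨η, hη, hf⟩ := Metric.uniformContinuous_iff.1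
    (CompactSpace.uniformContinuous_of_continuous f.continuous) c hc
  filter_upwards [hδ.eventually_lt_const hη] with r hr x z hz
  rw [← dist_eq_norm, dist_comm]
  exact (hf (((P r).dist_lt x z hz).trans hr)).le

theorem tendsto_compressionSum_sub_riemannSum {γ : ι → C(K, ℂ) →⋆ₐ[ℂ] A}
    (hγ : ∀ φ, IsAsymptoticallyCentral l fun i => γ i φ) (hδ : Tendsto δ p (𝓝 0))
    (P : ∀ r, TaggedPartition K (δ r)) {κ : ρ → Type*} [∀ r, Fintype (κ r)]
    {h : ∀ r, κ r → C(K, ℂ)} (hh : ∀ r, ∑ k, star (h r k) * h r k = 1) {y : ∀ r, κ r → A}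
    {f : C(K, A)} (hy : ∀ c > 0, ∀ᶠ r in p, ∀ k z, h r k z ≠ 0 → ‖y r k - f z‖ ≤ c) :
    Tendsto (fun q : ρ × ι => compressionSum (γ q.2) (h q.1) (y q.1) -
      riemannSum (γ q.2) (P q.1) f) (p.curry l) (𝓝 0) := by
  rw [NormedAddGroup.tendsto_nhds_zero]
  intro ε hε
  rw [eventually_curry_iff]
  filter_upwards [hy (ε / 4) (by positivity),
    TaggedPartition.eventually_norm_sub_le hδ P f (c := ε / 4) (by positivity)] with r hyr hfr
  have near : ∀ k (x : (P r).tags) z, h r k z ≠ 0 → (P r).weight x z ≠ 0 →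
      ‖y r k - f x‖ ≤ ε / 4 + ε / 4 := by
    intro k x z hk hx
    rw [← sub_sub_sub_cancel_right _ _ (f z)]
    exact norm_sub_le_of_le (hyr k z hk) (hfr x z hx)
  filter_upwards [eventually_norm_compressionSum_sub_le hγ (hh r) (P r).sum_star_mul_self
    (by positivity) (by linarith : _ < 3 * ε / 4) near] with i hi
  exact hi.trans_lt (by linarith)

end RiemannSum

section AsymptoticStarHom

/-- The maps `Φ i` form, along `l`, a unital star homomorphism in the limit; only multiplicativity
is allowed to fail at finite stages. -/
structure IsAsymptoticStarHom {A B ι : Type*} [CStarAlgebra A] [CStarAlgebra B] (l : Filter ι)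
    (Φ : ι → B →ₗ[ℂ] A) : Prop where
  map_one : ∀ i, Φ i 1 = 1
  map_star : ∀ i b, Φ i (star b) = star (Φ i b)
  norm_le : ∀ i b, ‖Φ i b‖ ≤ ‖b‖
  tendsto_mul_sub : ∀ b c, Tendsto (fun i => Φ i b * Φ i c - Φ i (b * c)) l (𝓝 0)

theorem IsAsymptoticStarHom.comp {A B D ι : Type*} [CStarAlgebra A] [CStarAlgebra B]
    [CStarAlgebra D] {l : Filter ι} {Φ : ι → B →ₗ[ℂ] A} (hΦ : IsAsymptoticStarHom l Φ)
    (θ : D →⋆ₐ[ℂ] B) : IsAsymptoticStarHom l fun i => Φ i ∘ₗ θ.toAlgHom.toLinearMap where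
  map_one i := by simp [hΦ.map_one]
  map_star i d := (congrArg (Φ i) (StarHomClass.map_star θ d)).trans (hΦ.map_star i _)
  norm_le i d := (hΦ.norm_le i _).trans (NonUnitalStarAlgHom.norm_apply_le θ d)
  tendsto_mul_sub d d' := by simpa using hΦ.tendsto_mul_sub (θ d) (θ d')

variable {A B K ι ρ : Type*} [CStarAlgebra A] [CStarAlgebra B] [PseudoMetricSpace K]
  [CompactSpace K] {l : Filter ι} {p : Filter ρ} {δ : ρ → ℝ} {γ : ι → C(K, ℂ) →⋆ₐ[ℂ] A}

theorem tendsto_curry_of_forall {X : Type*} [TopologicalSpace X] {F : ρ × ι → X} {x : X}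
    (hF : ∀ r, Tendsto (fun i => F (r, i)) l (𝓝 x)) : Tendsto F (p.curry l) (𝓝 x) :=
  Tendsto.curry (f := fun r i => F (r, i)) (.of_forall hF)

theorem neBot_curry [p.NeBot] [l.NeBot] : (p.curry l).NeBot := by
  refine ⟨fun h => ?_⟩
  simpa only [eventually_curry_iff, eventually_const] using eventually_false_iff_eq_bot.2 h

theorem isAsymptoticStarHom_riemannSum
    (hγ : ∀ φ, IsAsymptoticallyCentral l fun i => γ i φ) (hδ : Tendsto δ p (𝓝 0))
    (P : ∀ r, TaggedPartition K (δ r)) :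
    IsAsymptoticStarHom (p.curry l) fun q : ρ × ι => riemannSum (γ q.2) (P q.1) where
  map_one q := compressionSum_one _ (P q.1).sum_star_mul_self
  map_star q f := compressionSum_star _ _ _
  norm_le q f := norm_compressionSum_le _ (P q.1).sum_star_mul_self (norm_nonneg f)
    fun x _ _ => f.norm_coe_le_norm x
  tendsto_mul_sub f g := by
    have refine_partition : Tendsto (fun q : ρ × ι =>
        riemannSum (γ q.2) (P q.1) f * riemannSum (γ q.2) (P q.1) g -
          compressionSum (γ q.2) (fun x : (P q.1).tags × (P q.1).tags =>
            (P q.1).weight x.1 * (P q.1).weight x.2) fun x => f x.1 * g x.2)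
        (p.curry l) (𝓝 0) :=
      tendsto_curry_of_forall fun r => tendsto_compressionSum_mul_sub hγ (P r).weight
        (P r).weight (fun x => f x) fun x => g x
    have retag := tendsto_compressionSum_sub_riemannSum hγ hδ P (f := f * g)
      (fun r => sum_star_mul_self_prod (P r).sum_star_mul_self (P r).sum_star_mul_self)
      (y := fun r x => f x.1 * g x.2) ?_
    · have limit := refine_partition.add retag
      rw [add_zero] at limit
      exact limit.congr fun q => sub_add_sub_cancel _ _ _
    intro c hc
    have hη : 0 < c / (‖f‖ + ‖g‖ + 1) := by positivity
    filter_upwards [TaggedPartition.eventually_norm_sub_le hδ P f hη,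
      TaggedPartition.eventually_norm_sub_le hδ P g hη] with r hf hg x z hz
    calc ‖f x.1 * g x.2 - f z * g z‖ = ‖(f x.1 - f z) * g x.2 + f z * (g x.2 - g z)‖ := by
          congr 1; noncomm_ring
      _ ≤ c / (‖f‖ + ‖g‖ + 1) * ‖g‖ + ‖f‖ * (c / (‖f‖ + ‖g‖ + 1)) := norm_add_le_of_le
          (norm_mul_le_of_le (hf _ z (left_ne_zero_of_mul hz)) (g.norm_coe_le_norm _))
          (norm_mul_le_of_le (f.norm_coe_le_norm z) (hg _ z (right_ne_zero_of_mul hz)))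
      _ ≤ c := by
          rw [mul_comm, ← add_mul, mul_div_assoc', div_le_iff₀ (by positivity)]
          nlinarith

theorem tendsto_map_riemannSum_sub {β : A →⋆ₐ[ℂ] A} {σ : C(K, K)}
    (hγ : ∀ φ, IsAsymptoticallyCentral l fun i => γ i φ)
    (hβ : ∀ φ : C(K, ℂ), Tendsto (fun i => β (γ i φ) - γ i (φ.comp σ)) l (𝓝 0))
    (hδ : Tendsto δ p (𝓝 0))
    (P : ∀ r, TaggedPartition K (δ r)) {f g : C(K, A)} (hfg : ∀ z, g z = β (f (σ z))) :
    Tendsto (fun q : ρ × ι => β (riemannSum (γ q.2) (P q.1) f) - riemannSum (γ q.2) (P q.1) g)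
      (p.curry l) (𝓝 0) := by
  have transport : Tendsto (fun q : ρ × ι => compressionSum (β.comp (γ q.2)) (P q.1).weight
      (fun x => β (f x)) - compressionSum (γ q.2) (fun x => ((P q.1).weight x).comp σ)
      fun x => β (f x)) (p.curry l) (𝓝 0) :=
    tendsto_curry_of_forall fun r => tendsto_compressionSum_sub_compressionSum
      (γ := fun i => β.comp (γ i)) (δ := fun i => (γ i).comp (σ.compStarAlgHom' ℂ ℂ)) hβ
      (P r).weight fun x => β (f x)
  have retag := tendsto_compressionSum_sub_riemannSum hγ hδ P (f := g)
    (h := fun r x => ((P r).weight x).comp σ) (y := fun r x => β (f x)) (fun r => ?_) ?_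
  · have limit := transport.add retag
    rw [add_zero] at limit
    exact limit.congr fun q => by
      rw [sub_add_sub_cancel, ← map_compressionSum]; rfl
  · simpa only [map_sum, map_mul, map_star, map_one, ContinuousMap.compStarAlgHom'_apply] using
      congr(ContinuousMap.compStarAlgHom' ℂ ℂ σ $((P r).sum_star_mul_self))
  · intro c hc
    filter_upwards [TaggedPartition.eventually_norm_sub_le hδ P f hc] with r hr x z hz
    rw [hfg, ← map_sub]
    exact (NonUnitalStarAlgHom.norm_apply_le β _).trans (hr x (σ z) hz)

theorem tendsto_riemannSum_const (hγ : ∀ φ, IsAsymptoticallyCentral l fun i => γ i φ)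
    (hδ : Tendsto δ p (𝓝 0)) (P : ∀ r, TaggedPartition K (δ r)) (a : A) :
    Tendsto (fun q : ρ × ι => riemannSum (γ q.2) (P q.1) (.const K a)) (p.curry l) (𝓝 a) := by
  have limit := tendsto_compressionSum_sub_riemannSum hγ hδ P (f := .const K a)
    (κ := fun _ => Unit) (h := fun _ _ => 1) (y := fun _ _ => a) (by simp)
    (by simp +contextual [le_of_lt])
  simpa [compressionSum_apply] using limit.const_sub a

end AsymptoticStarHom

section CircleAction

/-- The coordinate function of the circle. -/
def circleCoord : C(Circle, ℂ) := ⟨fun z => z, by fun_prop⟩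

theorem eq_top_of_circleCoord_mem {S : StarSubalgebra ℂ C(Circle, ℂ)}
    (hS : IsClosed (S : Set C(Circle, ℂ))) (hcoord : circleCoord ∈ S) : S = ⊤ := by
  have separates : S.SeparatesPoints := fun z w hzw =>
    ⟨circleCoord, ⟨circleCoord, hcoord, rfl⟩, fun h => hzw (Circle.ext h)⟩
  rw [← ContinuousMap.starSubalgebra_topologicalClosure_eq_top_of_separatesPoints S separates]
  exact SetLike.coe_injective hS.closure_eq.symm

variable {A : Type*} [CStarAlgebra A]

/-- The continuous functional calculus of a unitary, extended from its spectrum to the whole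
circle. -/
def circleCalculus (u : unitary A) : C(Circle, ℂ) →⋆ₐ[ℂ] A :=
  (cfcHom (R := ℂ) (a := (u : A)) (p := IsStarNormal) inferInstance).comp
    (ContinuousMap.compStarAlgHom' ℂ ℂ
      ⟨fun z => (⟨z, spectrum.subset_circle_of_unitary u.2 z.2⟩ : Circle), by fun_prop⟩)

theorem circleCalculus_circleCoord (u : unitary A) : circleCalculus u circleCoord = u :=
  cfcHom_id (R := ℂ) (p := IsStarNormal) (a := (u : A)) inferInstance

variable {ι : Type*} {l : Filter ι} {u : ι → unitary A}

theorem isAsymptoticallyCentral_circleCalculus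
    (hu : IsAsymptoticallyCentral l fun i => (u i : A)) (φ : C(Circle, ℂ)) :
    IsAsymptoticallyCentral l fun i => circleCalculus (u i) φ := by
  intro a
  suffices asymptoticIntertwiner l (fun i => circleCalculus (u i)) (fun i => circleCalculus (u i))
      (fun _ => a) = ⊤ from (SetLike.ext_iff.1 this φ).2 trivial |>.1
  refine eq_top_of_circleCoord_mem (isClosed_asymptoticIntertwiner _ _ fun _ => le_rfl) ⟨?_, ?_⟩
  · simpa only [circleCalculus_circleCoord] using hu a
  · simpa only [map_star, circleCalculus_circleCoord, star_sub, star_mul, star_star, neg_sub,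
      star_zero, neg_zero] using (hu (star a)).star.neg

theorem tendsto_map_circleCalculus_sub {ζ : Circle} {β : A →⋆ₐ[ℂ] A}
    (hβ : Tendsto (fun i => β (u i) - (ζ : ℂ) • (u i : A)) l (𝓝 0)) (φ : C(Circle, ℂ)) :
    Tendsto (fun i => β (circleCalculus (u i) φ) -
      circleCalculus (u i) (φ.comp (.mulLeft ζ))) l (𝓝 0) := by
  suffices asymptoticIntertwiner l (fun i => β.comp (circleCalculus (u i)))
      (fun i => (circleCalculus (u i)).comp ((ContinuousMap.mulLeft ζ).compStarAlgHom' ℂ ℂ))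
      1 = ⊤ by
    simpa using ((SetLike.ext_iff.1 this φ).2 trivial).1
  have coord_rotate : circleCoord.comp (.mulLeft ζ) = (ζ : ℂ) • circleCoord := rfl
  refine eq_top_of_circleCoord_mem
    (isClosed_asymptoticIntertwiner _ _ (C := ‖(1 : A)‖) fun _ => le_rfl) ⟨?_, ?_⟩
  · simpa [coord_rotate, circleCalculus_circleCoord] using hβ
  · have star_comp : (star circleCoord).comp (.mulLeft ζ) = star (circleCoord.comp (.mulLeft ζ)) :=
      rfl
    simpa [star_comp, coord_rotate, map_star, circleCalculus_circleCoord] using hβ.star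

theorem CircleRokhlin.exists_net {α : Circle →* (A ≃⋆ₐ[ℂ] A)} (hR : CircleRokhlin α) :
    ∃ u : Finset A × ℕ → unitary A, (IsAsymptoticallyCentral atTop fun i => (u i : A)) ∧
      ∀ ζ : Circle, Tendsto (fun i => α ζ (u i) - (ζ : ℂ) • (u i : A)) atTop (𝓝 0) := by
  choose v hv hvα hvF using fun i : Finset A × ℕ =>
    hR i.1 (1 / ((i.2 : ℝ) + 1)) Nat.one_div_pos_of_nat
  have tendsto_zero : Tendsto (fun i : Finset A × ℕ => 1 / ((i.2 : ℝ) + 1)) atTop (𝓝 0) := by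
    rw [← prod_atTop_atTop_eq]
    exact tendsto_one_div_add_atTop_nhds_zero_nat.comp tendsto_snd
  refine ⟨fun i => ⟨v i, hv i⟩, fun a => ?_, fun ζ => ?_⟩
  · refine squeeze_zero_norm' ?_ tendsto_zero
    filter_upwards [eventually_ge_atTop ({a}, 0)] with i hi
    exact (hvF i a (hi.1 (Finset.mem_singleton_self a))).le
  · exact squeeze_zero_norm (fun i => (hvα i ζ).le) tendsto_zero

theorem IsContinuousAction.continuous_uncurry {G : Type*} [Group G] [TopologicalSpace G]
    {α : G →* (A ≃⋆ₐ[ℂ] A)} (hα : IsContinuousAction α) :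
    Continuous fun p : A × G => α p.2 p.1 :=
  continuous_prod_of_continuous_lipschitzWith _ 1 hα fun g =>
    LipschitzWith.of_dist_le_mul fun a b => by
      simpa only [dist_eq_norm, map_sub, NNReal.coe_one, one_mul] using
        NonUnitalStarAlgHom.norm_apply_le (α g) (a - b)

/-- The orbit map `z ↦ α z a`. -/
def IsContinuousAction.orbit {G : Type*} [Group G] [TopologicalSpace G]
    {α : G →* (A ≃⋆ₐ[ℂ] A)} (hα : IsContinuousAction α) (a : A) : C(G, A) := ⟨_, hα a⟩

/-- The automorphism of `C(G, A)` that untwists orbit maps into constant functions. -/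
def IsContinuousAction.untwist {G : Type*} [Group G] [TopologicalSpace G] [IsTopologicalGroup G]
    {α : G →* (A ≃⋆ₐ[ℂ] A)} (hα : IsContinuousAction α) : C(G, A) →⋆ₐ[ℂ] C(G, A) where
  toFun f := ⟨fun z => α z⁻¹ (f z),
    hα.continuous_uncurry.comp (f.continuous.prodMk continuous_inv)⟩
  map_one' := by ext; simp
  map_mul' f g := by ext; simp
  map_zero' := by ext; simp
  map_add' f g := by ext; simp
  commutes' c := by ext; simp
  map_star' f := ContinuousMap.ext fun z => map_star (α z⁻¹) (f z)

theorem IsContinuousAction.orbit_apply {G : Type*} [Group G] [TopologicalSpace G]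
    {α : G →* (A ≃⋆ₐ[ℂ] A)} (hα : IsContinuousAction α) (a : A) (z : G) :
    hα.orbit a z = α z a := rfl

theorem IsContinuousAction.untwist_apply {G : Type*} [Group G] [TopologicalSpace G]
    [IsTopologicalGroup G] {α : G →* (A ≃⋆ₐ[ℂ] A)} (hα : IsContinuousAction α) (f : C(G, A))
    (z : G) : hα.untwist f z = α z⁻¹ (f z) := rfl

theorem CircleRokhlin.exists_isAsymptoticStarHom {α : Circle →* (A ≃⋆ₐ[ℂ] A)}
    (hR : CircleRokhlin α) (hα : IsContinuousAction α) :
    ∃ (l : Filter (ℕ × (Finset A × ℕ))) (Φ : ℕ × (Finset A × ℕ) → C(Circle, A) →ₗ[ℂ] A),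
      l.NeBot ∧ IsAsymptoticStarHom l Φ ∧
      (∀ ζ f, Tendsto (fun i => α ζ (Φ i f) - Φ i (f.comp (.mulLeft ζ))) l (𝓝 0)) ∧
      ∀ a, Tendsto (fun i => Φ i (hα.orbit a)) l (𝓝 a) := by
  classical
  obtain ⟨u, central, equivariant⟩ := hR.exists_net
  have hγ := isAsymptoticallyCentral_circleCalculus central
  have hδ : Tendsto (fun r : ℕ => 1 / ((r : ℝ) + 1)) atTop (𝓝 0) :=
    tendsto_one_div_add_atTop_nhds_zero_nat
  have P (r : ℕ) : TaggedPartition Circle (1 / ((r : ℝ) + 1)) :=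
    (TaggedPartition.nonempty Nat.one_div_pos_of_nat).some
  refine ⟨_, _, neBot_curry, (isAsymptoticStarHom_riemannSum hγ hδ P).comp hα.untwist,
    fun ζ f => ?_, fun a => ?_⟩
  · refine tendsto_map_riemannSum_sub (β := (α ζ : A →⋆ₐ[ℂ] A)) (σ := .mulLeft ζ) hγ
      (tendsto_map_circleCalculus_sub (equivariant ζ)) hδ P fun z => ?_
    change hα.untwist (f.comp (.mulLeft ζ)) z = α ζ (hα.untwist f (ζ * z))
    rw [hα.untwist_apply, hα.untwist_apply, ← StarAlgEquiv.mul_apply, ← map_mul, mul_inv,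
      mul_inv_cancel_left, ContinuousMap.comp_apply, ContinuousMap.coe_mulLeft]
  · have untwist_orbit : hα.untwist (hα.orbit a) = .const Circle a := by
      ext z
      rw [hα.untwist_apply, hα.orbit_apply, ← StarAlgEquiv.mul_apply, ← map_mul, inv_mul_cancel,
        map_one, StarAlgEquiv.one_apply, ContinuousMap.const_apply]
    simpa [untwist_orbit] using tendsto_riemannSum_const hγ hδ P a

end CircleAction

section Lifting

variable {A B ι : Type*} [CStarAlgebra A] [CStarAlgebra B] {l : Filter ι} {Φ : ι → B →ₗ[ℂ] A}

theorem norm_aeval_sub_cfc_le {a : A} (ha : IsSelfAdjoint a) {R ε : ℝ} (hε : 0 ≤ ε)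
    (haR : ‖a‖ ≤ R) {f : ℝ → ℝ} (hf : Continuous f) {p : Polynomial ℝ}
    (hp : ∀ t ∈ Set.Icc (-R) R, |p.eval t - f t| ≤ ε) : ‖Polynomial.aeval a p - cfc f a‖ ≤ ε := by
  rw [← cfc_polynomial p a, ← cfc_sub _ _ a p.continuous.continuousOn hf.continuousOn]
  refine norm_cfc_le hε fun t ht => hp t (abs_le.1 ?_)
  rcases subsingleton_or_nontrivial A with _ | _
  · simp [spectrum.of_subsingleton] at ht
  · exact (spectrum.norm_le_norm_of_mem ht).trans haR

theorem IsAsymptoticStarHom.isSelfAdjoint_apply (hΦ : IsAsymptoticStarHom l Φ) {b : B}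
    (hb : IsSelfAdjoint b) (i : ι) : IsSelfAdjoint (Φ i b) :=
  (hΦ.map_star i b).symm.trans (congrArg (Φ i) hb.star_eq)

theorem IsAsymptoticStarHom.tendsto_aeval (hΦ : IsAsymptoticStarHom l Φ) (b : B)
    (p : Polynomial ℝ) :
    Tendsto (fun i => Polynomial.aeval (Φ i b) p - Φ i (Polynomial.aeval b p)) l (𝓝 0) := by
  have bounded (i : ι) : ‖Φ i b‖ ≤ ‖b‖ := hΦ.norm_le i b
  have map_real (i : ι) (r : ℝ) : Φ i (algebraMap ℝ B r) = algebraMap ℝ A r := by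
    rw [Algebra.algebraMap_eq_smul_one, LinearMap.map_smul_of_tower, hΦ.map_one,
      ← Algebra.algebraMap_eq_smul_one]
  induction p using Polynomial.induction_on with
  | C r => simp [map_real, tendsto_const_nhds]
  | add p q hp hq =>
    simpa only [map_add, add_zero, add_sub_add_comm] using hp.add hq
  | monomial k r ih =>
    have step := (ih.zero_mul_isBoundedUnder_le
      (isBoundedUnder_of ⟨‖b‖, bounded⟩)).add
      (hΦ.tendsto_mul_sub (Polynomial.aeval b (Polynomial.C r * Polynomial.X ^ k)) b)
    rw [add_zero] at step
    refine step.congr fun i => ?_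
    rw [pow_succ, ← mul_assoc, map_mul _ _ Polynomial.X, map_mul _ _ Polynomial.X,
      Polynomial.aeval_X, Polynomial.aeval_X, sub_mul, sub_add_sub_cancel]

theorem IsAsymptoticStarHom.tendsto_cfc (hΦ : IsAsymptoticStarHom l Φ) {b : B}
    (hb : IsSelfAdjoint b) {f : ℝ → ℝ} (hf : Continuous f) :
    Tendsto (fun i => cfc f (Φ i b) - Φ i (cfc f b)) l (𝓝 0) := by
  rw [NormedAddGroup.tendsto_nhds_zero]
  intro ε hε
  obtain ⟨p, hp⟩ := exists_polynomial_near_of_continuousOn (-‖b‖) ‖b‖ f hf.continuousOn (ε / 3)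
    (by positivity)
  filter_upwards [NormedAddGroup.tendsto_nhds_zero.1 (hΦ.tendsto_aeval b p) (ε / 3)
    (by positivity)] with i hi
  have approx_target := norm_aeval_sub_cfc_le (hΦ.isSelfAdjoint_apply hb i) (by positivity)
    (hΦ.norm_le i b) hf fun t ht => (hp t ht).le
  have approx_source := (hΦ.norm_le i _).trans
    (norm_aeval_sub_cfc_le hb (by positivity) le_rfl hf fun t ht => (hp t ht).le)
  rw [map_sub] at approx_source
  rw [norm_sub_rev] at approx_target
  calc ‖cfc f (Φ i b) - Φ i (cfc f b)‖
      ≤ ‖cfc f (Φ i b) - Polynomial.aeval (Φ i b) p‖ +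
          ‖Polynomial.aeval (Φ i b) p - Φ i (Polynomial.aeval b p)‖ +
          ‖Φ i (Polynomial.aeval b p) - Φ i (cfc f b)‖ := by
        rw [← sub_add_sub_cancel _ (Φ i (Polynomial.aeval b p)),
          ← sub_add_sub_cancel _ (Polynomial.aeval (Φ i b) p)]
        exact norm_add₃_le
    _ < ε := by linarith

theorem IsAsymptoticStarHom.eventually_infDist_spectrum_lt (hΦ : IsAsymptoticStarHom l Φ) {b : B}
    (hb : IsSelfAdjoint b) {X : Set ℝ} (hX : spectrum ℝ b ⊆ X) {δ : ℝ} (hδ : 0 < δ) :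
    ∀ᶠ i in l, ∀ t ∈ spectrum ℝ (Φ i b), Metric.infDist t X < δ := by
  have cont : Continuous fun t => Metric.infDist t X := Metric.continuous_infDist_pt X
  have vanish : cfc (fun t => Metric.infDist t X) b = 0 := by
    rw [cfc_congr fun t ht => Metric.infDist_zero_of_mem (hX ht), cfc_const_zero]
  have limit := hΦ.tendsto_cfc hb cont
  simp only [vanish, map_zero, sub_zero] at limit
  filter_upwards [NormedAddGroup.tendsto_nhds_zero.1 limit δ hδ] with i hi t ht
  have := norm_apply_le_norm_cfc _ _ ht cont.continuousOn (hΦ.isSelfAdjoint_apply hb i)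
  exact (le_abs_self _).trans_lt (this.trans_lt hi)

/-- A continuous function equal to `1` within distance `1/4` of `s` and to `0` outside distance
`1/2`. -/
def nodeBump (s t : ℝ) : ℝ := max 0 (min 1 (2 - 4 * dist t s))

theorem continuous_nodeBump (s : ℝ) : Continuous (nodeBump s) := by
  unfold nodeBump
  fun_prop

theorem nodeBump_eq_one {s t : ℝ} (h : dist t s < 1 / 4) : nodeBump s t = 1 := by
  rw [nodeBump, min_eq_left (by linarith), max_eq_right zero_le_one]

theorem nodeBump_eq_zero {s t : ℝ} (h : 1 / 2 ≤ dist t s) : nodeBump s t = 0 :=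
  max_eq_left ((min_le_right _ _).trans (by linarith))

variable {κ : Type*} {x : κ → ℝ}

theorem nodeBump_eq_single [DecidableEq κ] (hx : Pairwise fun g h => 1 ≤ dist (x g) (x h)) {t : ℝ}
    {g : κ} (ht : dist t (x g) < 1 / 4) (h : κ) :
    nodeBump (x h) t = (Pi.single g 1 : κ → ℝ) h := by
  obtain rfl | hgh := eq_or_ne h g
  · rw [nodeBump_eq_one ht, Pi.single_eq_same]
  · rw [Pi.single_eq_of_ne hgh]
    refine nodeBump_eq_zero ?_
    linarith [hx hgh, dist_triangle_left (x h) (x g) t]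

theorem isSelfAdjoint_ofReal_comp (x : κ → ℝ) : IsSelfAdjoint fun g => (x g : ℂ) :=
  funext fun g => Complex.conj_ofReal (x g)

theorem spectrum_map_pi_subset (ψ : (κ → ℂ) →⋆ₐ[ℂ] B) :
    spectrum ℝ (ψ fun h => (x h : ℂ)) ⊆ Set.range x := by
  refine (AlgHom.spectrum_apply_subset (ψ.toAlgHom.restrictScalars ℝ) _).trans ?_
  rw [Pi.spectrum_eq, Set.iUnion_subset_iff]
  intro h
  change spectrum ℝ (algebraMap ℝ ℂ (x h)) ⊆ _
  rw [spectrum.scalar_eq, Set.singleton_subset_iff]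
  exact ⟨h, rfl⟩

theorem cfc_nodeBump_map_pi [Finite κ] [DecidableEq κ]
    (hx : Pairwise fun g h => 1 ≤ dist (x g) (x h)) (ψ : (κ → ℂ) →⋆ₐ[ℂ] B) (g : κ) :
    cfc (nodeBump (x g)) (ψ fun h => (x h : ℂ)) = ψ (Pi.single g 1) := by
  cases nonempty_fintype κ
  have : ContinuousFunctionalCalculus ℝ (κ → ℂ) IsSelfAdjoint :=
    IsSelfAdjoint.instContinuousFunctionalCalculus
  have cont := continuous_nodeBump (x g)
  rw [← ψ.map_cfc _ _ cont.continuousOn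
      (LinearMap.continuous_of_finiteDimensional ψ.toAlgHom.toLinearMap)
      (isSelfAdjoint_ofReal_comp x) ((isSelfAdjoint_ofReal_comp x).map ψ),
    cfc_map_pi (S := ℂ) (q := fun _ => IsSelfAdjoint) _ _ cont.continuousOn
      (isSelfAdjoint_ofReal_comp x) fun h => Complex.conj_ofReal (x h)]
  congr 1
  ext h
  change cfc _ (algebraMap ℝ ℂ (x h)) = _
  rw [cfc_algebraMap, nodeBump_eq_single hx (g := h) (by simp)]
  simp [Pi.single_apply, eq_comm]

variable [Fintype κ]

theorem completeOrthogonalIdempotents_cfc_nodeBump {a : A} (ha : IsSelfAdjoint a)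
    (hx : Pairwise fun g h => 1 ≤ dist (x g) (x h))
    (hspec : ∀ t ∈ spectrum ℝ a, ∃ g, dist t (x g) < 1 / 4) :
    CompleteOrthogonalIdempotents fun g => cfc (nodeBump (x g)) a := by
  classical
  have cont (g : κ) := (continuous_nodeBump (x g)).continuousOn (s := spectrum ℝ a)
  refine ⟨⟨fun g => ?_, fun g h hgh => ?_⟩, ?_⟩
  · rw [IsIdempotentElem, ← cfc_mul _ _ a (cont g) (cont g)]
    refine cfc_congr fun t ht => ?_
    obtain ⟨k, hk⟩ := hspec t ht
    simp only [nodeBump_eq_single hx hk, Pi.single_apply]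
    split_ifs <;> norm_num
  · beta_reduce
    rw [← cfc_mul _ _ a (cont g) (cont h), ← cfc_const_zero ℝ a]
    refine cfc_congr fun t ht => ?_
    obtain ⟨k, hk⟩ := hspec t ht
    simp only [nodeBump_eq_single hx hk, Pi.single_apply]
    grind
  · rw [← cfc_sum_univ _ a (hf := cont), ← cfc_const_one ℝ a]
    refine cfc_congr fun t ht => ?_
    obtain ⟨k, hk⟩ := hspec t ht
    simp [nodeBump_eq_single hx hk]

theorem IsAsymptoticStarHom.eventually_exists_completeOrthogonalIdempotents [DecidableEq κ]
    [Nonempty κ] (hΦ : IsAsymptoticStarHom l Φ) (ψ : (κ → ℂ) →⋆ₐ[ℂ] B) {ε : ℝ} (hε : 0 < ε) :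
    ∀ᶠ i in l, ∃ e : κ → A, CompleteOrthogonalIdempotents e ∧ (∀ g, IsSelfAdjoint (e g)) ∧
      ∀ g, ‖e g - Φ i (ψ (Pi.single g 1))‖ < ε := by
  let x (g : κ) : ℝ := (Fintype.equivFin κ g : ℕ)
  have separated : Pairwise fun g h => 1 ≤ dist (x g) (x h) := fun g h hgh => by
    simpa [x] using Nat.pairwise_one_le_dist fun heq =>
      hgh ((Fintype.equivFin κ).injective (Fin.ext heq))
  have hb : IsSelfAdjoint (ψ fun h => (x h : ℂ)) := (isSelfAdjoint_ofReal_comp x).map ψ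
  have close (g : κ) := NormedAddGroup.tendsto_nhds_zero.1
    (hΦ.tendsto_cfc hb (continuous_nodeBump (x g))) ε hε
  filter_upwards [eventually_all.2 close, hΦ.eventually_infDist_spectrum_lt hb
    (spectrum_map_pi_subset ψ) (by norm_num : (0 : ℝ) < 1 / 4)] with i hi hspec
  refine ⟨_, completeOrthogonalIdempotents_cfc_nodeBump (hΦ.isSelfAdjoint_apply hb i) separated
    fun t ht => ?_, fun g => cfc_predicate _ _, fun g => ?_⟩
  · simpa using (Metric.infDist_lt_iff (Set.range_nonempty x)).1 (hspec t ht)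
  · rw [← cfc_nodeBump_map_pi separated ψ g]
    exact hi g

end Lifting

section UHFAbsorption

variable {n : ℕ}

theorem siteUnit_apply (k : ℕ) (i j : Fin n) (ξ : WordSpace n) (w : ℕ → Fin n) :
    siteUnit n k i j ξ w = if w k = i then ξ (Function.update w k j) else 0 := rfl

theorem siteUnit_mul_siteUnit (k : ℕ) (i j p q : Fin n) :
    siteUnit n k i j * siteUnit n k p q = if j = p then siteUnit n k i q else 0 := by
  ext ξ w
  by_cases hj : j = p <;> by_cases hw : w k = i <;> simp [siteUnit_apply, hj, hw]

theorem sum_siteUnit (k : ℕ) : ∑ i, siteUnit n k i i = 1 := by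
  ext ξ w
  have diagonal (i : Fin n) : siteUnit n k i i ξ w = if w k = i then ξ w else 0 := by
    rw [siteUnit_apply]
    split_ifs with h
    · rw [← h, Function.update_eq_self]
    · rfl
  rw [sum_apply, lp.coeFn_sum]
  exact (Finset.sum_apply _ _ _).trans (by simp [diagonal])

theorem commute_siteUnit {k m : ℕ} (hkm : k ≠ m) (i j p q : Fin n) :
    Commute (siteUnit n k i j) (siteUnit n m p q) := by
  ext ξ w
  by_cases hi : w k = i <;> by_cases hp : w m = p <;>
    simp [siteUnit_apply, hi, hp, hkm, hkm.symm, Function.update_comm hkm]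

/-- Exchange of the letters `i` and `j` at the `k`-th place of a word. -/
def swapLetter (k : ℕ) (i j : Fin n) : Equiv.Perm (ℕ → Fin n) :=
  Function.Involutive.toPerm (fun w => Function.update w k (Equiv.swap i j (w k)))
    fun w => by simp

theorem swapLetter_apply (k : ℕ) (i j : Fin n) (w : ℕ → Fin n) :
    swapLetter k i j w = Function.update w k (Equiv.swap i j (w k)) := rfl

theorem star_siteUnit (k : ℕ) (i j : Fin n) : star (siteUnit n k i j) = siteUnit n k j i := by
  rw [ContinuousLinearMap.star_eq_adjoint, eq_comm, ContinuousLinearMap.eq_adjoint_iff]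
  intro ξ η
  rw [lp.inner_eq_tsum, lp.inner_eq_tsum, ← (swapLetter k i j).tsum_eq]
  refine tsum_congr fun w => ?_
  rw [swapLetter_apply, siteUnit_apply, siteUnit_apply, Function.update_self,
    Function.update_idem]
  by_cases h : w k = i
  · have update_eq : Function.update w k i = w := by rw [← h, Function.update_eq_self]
    rw [if_pos h, if_pos (by simp [h]), update_eq, h, Equiv.swap_apply_left]
  · have swap_ne : Equiv.swap i j (w k) ≠ j := by
      rw [Ne, Equiv.swap_apply_eq_iff]
      simpa using h
    rw [if_neg h, if_neg swap_ne, inner_zero_left, inner_zero_right]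

/-- The action of `M_n` on the `k`-th letter of the words. -/
def siteHom (n k : ℕ) : Matrix (Fin n) (Fin n) ℂ →⋆ₐ[ℂ] (WordSpace n →L[ℂ] WordSpace n) :=
  have map_one : ∑ i, ∑ j, (1 : Matrix (Fin n) (Fin n) ℂ) i j • siteUnit n k i j = 1 := by
    simp [Matrix.one_apply, sum_siteUnit]
  { toFun M := ∑ i, ∑ j, M i j • siteUnit n k i j
    map_one' := map_one
    map_mul' M N := by
      simp only [Matrix.mul_apply, Finset.sum_smul, Finset.sum_mul, Finset.mul_sum,
        smul_mul_smul_comm, siteUnit_mul_siteUnit, smul_ite, smul_zero, Finset.sum_ite_eq',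
        Finset.mem_univ, if_true]
      rw [Finset.sum_comm_cycle]
      exact Finset.sum_congr rfl fun l _ => Finset.sum_comm
    map_zero' := by simp
    map_add' M N := by simp [add_smul, Finset.sum_add_distrib]
    commutes' c := by
      simp only [Algebra.algebraMap_eq_smul_one]
      simp [← map_one, Finset.smul_sum, mul_smul]
    map_star' M := by
      simp only [star_sum, star_smul, star_siteUnit]
      exact Finset.sum_comm }

theorem siteHom_apply (k : ℕ) (M : Matrix (Fin n) (Fin n) ℂ) :
    siteHom n k M = ∑ i, ∑ j, M i j • siteUnit n k i j := rfl

theorem siteHom_mem_uhfSubalgebra (k : ℕ) (M : Matrix (Fin n) (Fin n) ℂ) :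
    siteHom n k M ∈ uhfSubalgebra n := by
  have siteUnit_mem (i j : Fin n) : siteUnit n k i j ∈ uhfSubalgebra n := by
    refine StarSubalgebra.le_topologicalClosure _ (StarAlgebra.subset_adjoin ℂ _ ?_)
    exact ⟨k, i, j, rfl⟩
  rw [siteHom_apply]
  exact sum_mem fun i _ => sum_mem fun j _ => SMulMemClass.smul_mem _ (siteUnit_mem i j)

theorem commute_siteUnit_siteHom {k m : ℕ} (hkm : k ≠ m) (i j : Fin n)
    (M : Matrix (Fin n) (Fin n) ℂ) : Commute (siteUnit n k i j) (siteHom n m M) :=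
  .sum_right _ _ _ fun p _ => .sum_right _ _ _ fun q _ =>
    (commute_siteUnit hkm i j p q).smul_right _

/-- The embedding of `M_n` into `M_{n^∞}` as the `k`-th tensor factor. -/
def siteEmbedding (n k : ℕ) : Matrix (Fin n) (Fin n) ℂ →⋆ₐ[ℂ] UHF n :=
  (siteHom n k).codRestrict _ (siteHom_mem_uhfSubalgebra k)

open scoped Matrix.Norms.L2Operator in
theorem isAsymptoticallyCentral_siteEmbedding (M : Matrix (Fin n) (Fin n) ℂ) :
    IsAsymptoticallyCentral atTop fun k => siteEmbedding n k M := by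
  intro b
  have central : uhfSubalgebra n ≤ asymptoticIntertwiner atTop
      (fun _ => StarAlgHom.id ℂ _) (fun _ => StarAlgHom.id ℂ _) fun k => siteHom n k M := by
    refine StarSubalgebra.topologicalClosure_minimal (StarAlgebra.adjoin_le ?_)
      (isClosed_asymptoticIntertwiner _ _ (C := ‖M‖) fun k =>
        NonUnitalStarAlgHom.norm_apply_le (siteHom n k) M)
    have commutator (m : ℕ) (i j : Fin n) : Tendsto (fun k =>
        siteUnit n m i j * siteHom n k M - siteHom n k M * siteUnit n m i j) atTop (𝓝 0) := by
      refine tendsto_const_nhds.congr' ?_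
      filter_upwards [eventually_gt_atTop m] with k hk
      rw [(commute_siteUnit_siteHom hk.ne i j M).eq, sub_self]
    rintro _ ⟨m, i, j, rfl⟩
    exact ⟨commutator m i j, by
      simpa only [star_siteUnit, StarAlgHom.coe_id, id_eq] using commutator m j i⟩
  rw [tendsto_zero_iff_norm_tendsto_zero]
  exact (tendsto_zero_iff_norm_tendsto_zero.1 (central b.2).1).congr fun k => norm_sub_rev _ _

open scoped CStarAlgebra in
theorem IsCStarTensorProduct.isAsymptoticallyCentral_map {A B C ι : Type*} [CStarAlgebra A]
    [CStarAlgebra B] [CStarAlgebra C] {i : A →⋆ₐ[ℂ] C} {j : B →⋆ₐ[ℂ] C}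
    (h : IsCStarTensorProduct i j) {l : Filter ι} {T : ι → B} {R : ℝ} (hTR : ∀ k, ‖T k‖ ≤ R)
    (hT : IsAsymptoticallyCentral l T) : IsAsymptoticallyCentral l fun k => j (T k) := by
  intro c
  let S := asymptoticIntertwiner l (fun _ => StarAlgHom.id ℂ C) (fun _ => StarAlgHom.id ℂ C)
    fun k => j (T k)
  suffices c ∈ S by simpa using this.1.neg
  have left_mem (a : A) : i a ∈ S := by
    have commutator (a : A) : Tendsto (fun k => i a * j (T k) - j (T k) * i a) l (𝓝 0) := by
      simpa only [(h.commute a _).eq, sub_self] using tendsto_const_nhds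
    exact ⟨commutator a, by
      simpa only [map_star, StarAlgHom.coe_id, id_eq] using commutator (star a)⟩
  have right_mem (b : B) : j b ∈ S := by
    have commutator (b : B) : Tendsto (fun k => j b * j (T k) - j (T k) * j b) l (𝓝 0) := by
      have commutator_zero : Tendsto (fun k => b * T k - T k * b) l (𝓝 0) := by
        simpa only [neg_sub, neg_zero] using (hT b).neg
      have image_zero : Tendsto (fun k => j (b * T k - T k * b)) l (𝓝 (j 0)) :=
        ((map_continuous j).tendsto 0).comp commutator_zero
      simpa only [map_sub, map_mul, map_zero] using image_zero
    exact ⟨commutator b, by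
      simpa only [map_star, StarAlgHom.coe_id, id_eq] using commutator (star b)⟩
  have closed : IsClosed (S : Set C) := isClosed_asymptoticIntertwiner _ _ fun k =>
    (NonUnitalStarAlgHom.norm_apply_le j (T k)).trans (hTR k)
  refine closed.closure_subset_iff.2 ?_ (h.denseRange c)
  rintro _ ⟨t, rfl⟩
  induction t using TensorProduct.induction_on with
  | zero => rw [map_zero]; exact zero_mem S
  | add x y hx hy => rw [map_add]; exact add_mem hx hy
  | tmul a b => exact mul_mem (left_mem a) (right_mem b)

open scoped Matrix.Norms.L2Operator in
theorem AbsorbsUHF.exists_isAsymptoticallyCentral {A : Type*} [CStarAlgebra A]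
    (hA : AbsorbsUHF n A) : ∃ μ : ℕ → Matrix (Fin n) (Fin n) ℂ →⋆ₐ[ℂ] A,
      ∀ M, IsAsymptoticallyCentral atTop fun k => μ k M := by
  obtain ⟨i, j, h⟩ := hA
  exact ⟨fun k => j.comp (siteEmbedding n k), fun M => h.isAsymptoticallyCentral_map
    (fun k => NonUnitalStarAlgHom.norm_apply_le (siteEmbedding n k) M)
    (isAsymptoticallyCentral_siteEmbedding M)⟩

end UHFAbsorption

section RootVandermonde

open Matrix

variable {n : ℕ} [NeZero n]

/-- The normalised Vandermonde matrix of the `n` points of the circle obtained from `z` by rotation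
by the `n`-th roots of unity; it is unitary. -/
def rootVandermonde (n : ℕ) [NeZero n] (z : Circle) : Matrix (Fin n) (ZMod n) ℂ :=
  .of fun k g => (√n : ℂ)⁻¹ * ((ZMod.toCircle g * z : Circle) : ℂ) ^ (k : ℕ)

theorem rootVandermonde_toCircle_mul (g h : ZMod n) (z : Circle) (k : Fin n) :
    rootVandermonde n (ZMod.toCircle g * z) k h = rootVandermonde n z k (g + h) := by
  simp only [rootVandermonde, of_apply, AddChar.map_add_eq_mul]
  rw [mul_left_comm, mul_assoc]

theorem continuous_rootVandermonde : Continuous (rootVandermonde n) :=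
  continuous_matrix fun k g => by simp only [rootVandermonde, of_apply]; fun_prop

theorem sum_toCircle_pow (g : ZMod n) :
    ∑ k : Fin n, ((ZMod.toCircle g : Circle) : ℂ) ^ (k : ℕ) = if g = 0 then (n : ℂ) else 0 := by
  split_ifs with hg
  · simp [hg]
  · have root : ((ZMod.toCircle g : Circle) : ℂ) ^ n = 1 := by
      rw [← Circle.coe_pow, ← AddChar.map_nsmul_eq_pow, nsmul_eq_mul, ZMod.natCast_self, zero_mul,
        AddChar.map_zero_eq_one, Circle.coe_one]
    have ne_one : ((ZMod.toCircle g : Circle) : ℂ) ≠ 1 := by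
      rwa [← Circle.coe_one, Ne, Circle.coe_inj, ← AddChar.map_zero_eq_one (ZMod.toCircle (N := n)),
        ZMod.injective_toCircle.eq_iff]
    rw [Fin.sum_univ_eq_sum_range, geom_sum_eq ne_one, root, sub_self, zero_div]

theorem rootVandermonde_conjTranspose_mul_self (z : Circle) :
    (rootVandermonde n z)ᴴ * rootVandermonde n z = 1 := by
  ext g h
  have entry (k : Fin n) : star (rootVandermonde n z k g) * rootVandermonde n z k h =
      (n : ℂ)⁻¹ * ((ZMod.toCircle (h - g) : Circle) : ℂ) ^ (k : ℕ) := by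
    have rotate : star (((ZMod.toCircle g * z : Circle) : ℂ) ^ (k : ℕ)) *
        ((ZMod.toCircle h * z : Circle) : ℂ) ^ (k : ℕ) =
          ((ZMod.toCircle (h - g) : Circle) : ℂ) ^ (k : ℕ) := by
      rw [star_pow, ← mul_pow, Complex.star_def, ← Circle.coe_inv_eq_conj, ← Circle.coe_mul,
        inv_mul_eq_div, mul_div_mul_right_eq_div, AddChar.map_sub_eq_div]
    have sqrt_mul : star (√n : ℂ)⁻¹ * (√n : ℂ)⁻¹ = (n : ℂ)⁻¹ := by
      rw [Complex.star_def, map_inv₀, Complex.conj_ofReal, ← mul_inv, ← Complex.ofReal_mul,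
        Real.mul_self_sqrt n.cast_nonneg, Complex.ofReal_natCast]
    simp only [rootVandermonde, of_apply, star_mul', ← rotate, ← sqrt_mul]
    ring
  simp_rw [mul_apply, conjTranspose_apply, entry, ← Finset.mul_sum, sum_toCircle_pow, one_apply,
    sub_eq_zero, eq_comm (a := h)]
  split_ifs <;> simp [NeZero.ne n]

theorem rootVandermonde_mul_conjTranspose_self (z : Circle) :
    rootVandermonde n z * (rootVandermonde n z)ᴴ = 1 :=
  (mul_eq_one_comm_of_card_eq _ _ _ (by simp [ZMod.card])).1
    (rootVandermonde_conjTranspose_mul_self z)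

/-- The unital embedding of `C(ℤ_n)` into `C(𝕋, M_n)` onto the functions that are diagonal in the
columns of `rootVandermonde`: it intertwines the translations of `ℤ_n` with the rotations of the
circle by `n`-th roots of unity. -/
def rotatingDiagonal (n : ℕ) [NeZero n] :
    (ZMod n → ℂ) →⋆ₐ[ℂ] C(Circle, Matrix (Fin n) (Fin n) ℂ) where
  toFun c := ⟨fun z => rootVandermonde n z * diagonal c * (rootVandermonde n z)ᴴ,
    have := continuous_rootVandermonde (n := n); by fun_prop⟩
  map_one' := by ext1 z; simp [rootVandermonde_mul_conjTranspose_self]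
  map_mul' c d := by
    ext1 z
    have diagonal_mul : diagonal (c * d) = diagonal c * diagonal d :=
      (diagonal_mul_diagonal c d).symm
    simp only [ContinuousMap.mul_apply, ContinuousMap.coe_mk, diagonal_mul, Matrix.mul_assoc]
    rw [← Matrix.mul_assoc _ᴴ (rootVandermonde n z), rootVandermonde_conjTranspose_mul_self,
      Matrix.one_mul]
  map_zero' := by ext1 z; simp
  map_add' c d := by
    ext1 z
    have diagonal_add : diagonal (c + d) = diagonal c + diagonal d := (diagonal_add c d).symm
    simp only [ContinuousMap.add_apply, ContinuousMap.coe_mk, diagonal_add, Matrix.mul_add,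
      Matrix.add_mul]
  commutes' c := by
    ext1 z
    simp [rootVandermonde_mul_conjTranspose_self, Algebra.algebraMap_eq_smul_one]
  map_star' c := by
    ext1 z
    simp [star_eq_conjTranspose, Matrix.mul_assoc, diagonal_conjTranspose]

theorem rotatingDiagonal_single_comp_mulLeft (g h : ZMod n) :
    (rotatingDiagonal n (Pi.single h 1)).comp (.mulLeft (ZMod.toCircle g)) =
      rotatingDiagonal n (Pi.single (g + h) 1) := by
  ext z k l
  have entry (z : Circle) (h : ZMod n) : rotatingDiagonal n (Pi.single h 1) z k l =
      rootVandermonde n z k h * star (rootVandermonde n z l h) := by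
    change (rootVandermonde n z * diagonal (Pi.single h (1 : ℂ)) * (rootVandermonde n z)ᴴ) k l = _
    rw [mul_apply]
    simp [mul_diagonal, Pi.single_apply]
  rw [ContinuousMap.comp_apply, ContinuousMap.coe_mulLeft, entry, entry,
    rootVandermonde_toCircle_mul, rootVandermonde_toCircle_mul]

end RootVandermonde

section Restriction

open scoped Matrix.Norms.L2Operator CStarAlgebra in
theorem AbsorbsUHF.exists_isAsymptoticallyCentral_equivariant {A : Type*} [CStarAlgebra A] {n : ℕ}
    [NeZero n] (hA : AbsorbsUHF n A) :
    ∃ ψ : ℕ → (ZMod n → ℂ) →⋆ₐ[ℂ] C(Circle, A),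
      (∀ c, IsAsymptoticallyCentral atTop fun k => ψ k c) ∧
      ∀ k g h, (ψ k (Pi.single h 1)).comp (.mulLeft (ZMod.toCircle g)) =
        ψ k (Pi.single (g + h) 1) := by
  obtain ⟨μ, hμ⟩ := hA.exists_isAsymptoticallyCentral
  refine ⟨fun k => (ContinuousMap.compStarAlgHom Circle (μ k) (map_continuous (μ k))).comp
    (rotatingDiagonal n), fun c => .comp_continuousMap hμ _, fun k g h => ?_⟩
  rw [StarAlgHom.comp_apply, StarAlgHom.comp_apply, ← rotatingDiagonal_single_comp_mulLeft]
  rfl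

theorem IsAsymptoticStarHom.eventually_norm_commutator_lt {A B ι : Type*} [CStarAlgebra A]
    [CStarAlgebra B] {l : Filter ι} {Φ : ι → B →ₗ[ℂ] A} (hΦ : IsAsymptoticStarHom l Φ) {b f : B}
    {a : A} (hf : Tendsto (fun i => Φ i f) l (𝓝 a)) {ε : ℝ} (hb : ‖b * f - f * b‖ < ε) :
    ∀ᶠ i in l, ‖Φ i b * a - a * Φ i b‖ < ε := by
  have bounded : l.IsBoundedUnder (· ≤ ·) fun i => ‖Φ i b‖ :=
    isBoundedUnder_of ⟨‖b‖, fun i => hΦ.norm_le i b⟩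
  have hfa : Tendsto (fun i => a - Φ i f) l (𝓝 0) := by
    simpa only [sub_self] using (tendsto_const_nhds (x := a)).sub hf
  have error : Tendsto (fun i => Φ i b * a - a * Φ i b - Φ i (b * f - f * b)) l (𝓝 0) := by
    have left : Tendsto (fun i => Φ i b * (a - Φ i f)) l (𝓝 0) :=
      isBoundedUnder_le_mul_tendsto_zero bounded hfa
    have right : Tendsto (fun i => (a - Φ i f) * Φ i b) l (𝓝 0) :=
      hfa.zero_mul_isBoundedUnder_le bounded
    have total := (left.sub right).add ((hΦ.tendsto_mul_sub b f).sub (hΦ.tendsto_mul_sub f b))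
    simp only [sub_zero, add_zero] at total
    refine total.congr fun i => ?_
    rw [map_sub]
    noncomm_ring
  filter_upwards [NormedAddGroup.tendsto_nhds_zero.1 error _ (sub_pos.2 hb)] with i hi
  have triangle := norm_add_le (Φ i b * a - a * Φ i b - Φ i (b * f - f * b)) (Φ i (b * f - f * b))
  rw [sub_add_cancel] at triangle
  linarith [hΦ.norm_le i (b * f - f * b)]

theorem finiteRokhlin_of_approximate {G A : Type*} [Group G] [Fintype G] [CStarAlgebra A]
    {β : G →* (A ≃⋆ₐ[ℂ] A)}
    (approx : ∀ (F : Finset A) (ε : ℝ), 0 < ε → ∃ e p : G → A,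
      CompleteOrthogonalIdempotents e ∧ (∀ g, IsSelfAdjoint (e g)) ∧ (∀ g, ‖e g - p g‖ < ε) ∧
      (∀ g h, ‖β g (p h) - p (g * h)‖ < ε) ∧ ∀ g, ∀ a ∈ F, ‖p g * a - a * p g‖ < ε) :
    FiniteRokhlin β := by
  intro F ε hε
  obtain ⟨C, hC⟩ := (F.finite_toSet.image norm).bddAbove
  obtain ⟨e, p, he, selfAdjoint, near, equivariant, central⟩ :=
    approx F (ε / (2 * |C| + 3)) (by positivity)
  have budget : (2 * |C| + 3) * (ε / (2 * |C| + 3)) = ε := by field_simp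
  set δ := ε / (2 * |C| + 3)
  have hδ : 0 < δ := by positivity
  refine ⟨e, fun g => ⟨he.idem g, selfAdjoint g⟩, fun g h => he.ortho (i := g) (j := h),
    fun g h => ?_, fun g a ha => ?_, he.complete⟩
  · have isometry : ‖β g (e h - p h)‖ ≤ ‖e h - p h‖ := NonUnitalStarAlgHom.norm_apply_le (β g) _
    calc ‖β g (e h) - e (g * h)‖
        = ‖β g (e h - p h) + (β g (p h) - p (g * h)) - (e (g * h) - p (g * h))‖ := by
          rw [map_sub]; congr 1; abel
      _ ≤ ‖β g (e h - p h)‖ + ‖β g (p h) - p (g * h)‖ + ‖e (g * h) - p (g * h)‖ :=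
          norm_sub_le_of_le (norm_add_le _ _) le_rfl
      _ < δ + δ + δ := by linarith [near h, near (g * h), equivariant g h]
      _ ≤ ε := by linarith [mul_nonneg (abs_nonneg C) hδ.le]
  · have norm_a : ‖a‖ ≤ |C| := (hC ⟨a, ha, rfl⟩).trans (le_abs_self C)
    calc ‖e g * a - a * e g‖
        = ‖(e g - p g) * a - a * (e g - p g) + (p g * a - a * p g)‖ := by noncomm_ring
      _ ≤ ‖e g - p g‖ * ‖a‖ + ‖a‖ * ‖e g - p g‖ + ‖p g * a - a * p g‖ :=
          norm_add_le_of_le (norm_sub_le_of_le (norm_mul_le _ _) (norm_mul_le _ _)) le_rfl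
      _ ≤ δ * |C| + |C| * δ + δ := by gcongr; exacts [(near g).le, (near g).le, (central g a ha).le]
      _ < ε := by linarith

end Restriction

end RokhlinCircle

end

open Filter RokhlinCircle in
theorem mainTheorem3_general {A : Type*} [CStarAlgebra A]
    (n : ℕ) [NeZero n] (α : Circle →* (A ≃⋆ₐ[ℂ] A))
    (hα : IsContinuousAction α) (hR : CircleRokhlin α)
    (hA : AbsorbsUHF n A) :
    FiniteRokhlin (restrictCyclic α n) := by
  refine finiteRokhlin_of_approximate fun F ε hε => ?_
  obtain ⟨ψ, central, rotate⟩ := hA.exists_isAsymptoticallyCentral_equivariant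
  obtain ⟨l, Φ, _, hΦ, equivariant, orbit⟩ := hR.exists_isAsymptoticStarHom hα
  obtain ⟨k, hk⟩ : ∃ k, ∀ g, ∀ a ∈ F,
      ‖ψ k (Pi.single g 1) * hα.orbit a - hα.orbit a * ψ k (Pi.single g 1)‖ < ε :=
    (eventually_all.2 fun g => F.eventually_all.2 fun a _ =>
      NormedAddGroup.tendsto_nhds_zero.1 (central _ (hα.orbit a)) ε hε).exists
  let p i g := Φ i (ψ k (Pi.single g 1))
  have p_central : ∀ᶠ i in l, ∀ g, ∀ a ∈ F, ‖p i g * a - a * p i g‖ < ε :=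
    eventually_all.2 fun g => F.eventually_all.2 fun a ha =>
      hΦ.eventually_norm_commutator_lt (orbit a) (hk g a ha)
  have p_equivariant : ∀ᶠ i in l, ∀ g h, ‖α (ZMod.toCircle g) (p i h) - p i (g + h)‖ < ε :=
    eventually_all.2 fun g => eventually_all.2 fun h => by
      simpa only [rotate] using NormedAddGroup.tendsto_nhds_zero.1
        (equivariant (ZMod.toCircle g) (ψ k (Pi.single h 1))) ε hε
  obtain ⟨i, ⟨e, he, selfAdjoint, near⟩, hpα, hpF⟩ :=
    ((hΦ.eventually_exists_completeOrthogonalIdempotents (ψ k) hε).and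
      (p_equivariant.and p_central)).exists
  exact ⟨e ∘ Multiplicative.toAdd, p i ∘ Multiplicative.toAdd,
    (CompleteOrthogonalIdempotents.equiv Multiplicative.toAdd).2 he, fun g => selfAdjoint _,
    fun g => near _, fun g h => hpα _ _, fun g => hpF _⟩

theorem mainTheorem3 {A : Type*} [CStarAlgebra A] [TopologicalSpace.SeparableSpace A]
    (n : ℕ) [NeZero n] (α : Circle →* (A ≃⋆ₐ[ℂ] A))
    (hα : RokhlinCircle.IsContinuousAction α) (hR : RokhlinCircle.CircleRokhlin α)
    (hA : RokhlinCircle.AbsorbsUHF n A) :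
    RokhlinCircle.FiniteRokhlin (RokhlinCircle.restrictCyclic α n) :=
  mainTheorem3_general n α hα hR hA
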